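/- Let $M$ be a connected smooth ($C^\infty$) finite-dimensional manifold (Hausdorff, second countable, without boundary) and let $\Phi: M\times\mathbb{R}\to M$ be a smooth global flow with fixed-point set $\operatorname{Fix}\Phi$ and generating vector field $F(x)=\frac{\partial\Phi}{\partial t}(x,0)$. Define the shift map $\mathrm{Sh}: C^\infty(M,\mathbb{R})\to C^\infty(M,M)$ by $\mathrm{Sh}(\alpha)(x)=\Phi(x,\alpha(x))$. Let $\mathcal{E}(\Phi)\subset C^\infty(M,M)$ be the set of smooth maps $f$ such that $f(\omega)\subset\omega$ for each trajectory $\omega$ of $\Phi$ and the tangent map $T_zf: T_zM\to T_zM$ is an isomorphism for each $z\in\operatorname{Fix}\Phi$. Let $\mathcal{D}(\Phi)=\mathcal{E}(\Phi)\cap\operatorname{Diff}(M)$, and let $\mathcal{E}_{\mathrm{id}}(\Phi)$ and $\mathcal{D}_{\mathrm{id}}(\Phi)$ be the path components of $\mathrm{id}_M$ in $\mathcal{E}(\Phi)$ and $\mathcal{D}(\Phi)$, respectively, in the compact-open topology. Let $$\Gamma^+=\{\alpha\in C^\infty(M,\mathbb{R}) : \mathrm{Sh}(\alpha)\in\operatorname{Diff}(M),\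 d\alpha(F(x))>-1\ \text{for all } x\in M\}.$$ Suppose that $\operatorname{Int}\operatorname{Fix}\Phi=\emptyset$ and that each $z\in\operatorname{Fix}\Phi$ has the following extension property: there is an open neighborhood $V$ of $z$ such that, whenever $\alpha: V\setminus\operatorname{Fix}\Phi\to\mathbb{R}$ is a $C^\infty$ function for which the map $x\mapsto\Phi(x,\alpha(x))$ from $V\setminus\operatorname{Fix}\Phi$ to $M$ has a $C^\infty$ extension $V\to M$, the function $\alpha$ has a $C^\infty$ extension $V\to\mathbb{R}$. Then $$\operatorname{Im}\mathrm{Sh}=\mathcal{E}_{\mathrm{id}}(\Phi)\qquad\text{and}\qquad \mathrm{Sh}(\Gamma^+)=\mathcal{D}_{\mathrm{id}}(\Phi).$$ -/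

import Mathlib

open Set Topology
open scoped Manifold ContDiff

namespace ShiftMap

noncomputable section

variable {n : ℕ} {M : Type*} [TopologicalSpace M] [ChartedSpace (EuclideanSpace ℝ (Fin n)) M]

/-- The global flow `Φ` is smooth, as a map `(x, t) ↦ Φ t x` on `M × ℝ`. -/
def IsSmoothFlow (n : ℕ) {M : Type*} [TopologicalSpace M]
    [ChartedSpace (EuclideanSpace ℝ (Fin n)) M] (Φ : Flow ℝ M) : Prop :=
  ContMDiff ((𝓡 n).prod 𝓘(ℝ, ℝ)) (𝓡 n) ∞ (fun p : M × ℝ => Φ p.2 p.1)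

/-- The fixed-point set of a flow. -/
def Fix {M : Type*} [TopologicalSpace M] (Φ : Flow ℝ M) : Set M :=
  {x | ∀ t : ℝ, Φ t x = x}

/-- The vector field `F(x) = ∂Φ/∂t (x, 0)` generating the flow. -/
def field (n : ℕ) {M : Type*} [TopologicalSpace M]
    [ChartedSpace (EuclideanSpace ℝ (Fin n)) M] (Φ : Flow ℝ M) (x : M) :
    TangentSpace (𝓡 n) x :=
  mfderiv 𝓘(ℝ, ℝ) (𝓡 n) (fun t : ℝ => Φ t x) 0 (1 : ℝ)

/-- The shift map `Sh(α)(x) = Φ(x, α(x))` on smooth functions. Its values are regarded as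
elements of `C(M, M)`, which carries the compact-open topology. -/
def shift (Φ : Flow ℝ M) (α : C^∞⟮𝓡 n, M; 𝓘(ℝ, ℝ), ℝ⟯) : C(M, M) where
  toFun x := Φ (α x) x
  continuous_toFun := Φ.continuous α.contMDiff.continuous continuous_id

/-- `E(Φ)`: smooth self-maps that send each trajectory into itself and whose tangent map is an
isomorphism at each fixed point. -/
def E (n : ℕ) {M : Type*} [TopologicalSpace M]
    [ChartedSpace (EuclideanSpace ℝ (Fin n)) M] (Φ : Flow ℝ M) : Set C(M, M) :=
  {f | ContMDiff (𝓡 n) (𝓡 n) ∞ f ∧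
    (∀ x : M, f '' Φ.orbit x ⊆ Φ.orbit x) ∧
    ∀ z ∈ Fix Φ, Function.Bijective (mfderiv (𝓡 n) (𝓡 n) f z)}

/-- The smooth diffeomorphisms of `M`. -/
def Diff (n : ℕ) (M : Type*) [TopologicalSpace M]
    [ChartedSpace (EuclideanSpace ℝ (Fin n)) M] : Set C(M, M) :=
  {f | ∃ g : M ≃ₘ^∞⟮𝓡 n, 𝓡 n⟯ M, ⇑g = ⇑f}

/-- `D(Φ) = E(Φ) ∩ Diff(M)`. -/
def D (n : ℕ) {M : Type*} [TopologicalSpace M]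
    [ChartedSpace (EuclideanSpace ℝ (Fin n)) M] (Φ : Flow ℝ M) : Set C(M, M) :=
  E n Φ ∩ Diff n M

/-- The identity path component of `E(Φ)` in the compact-open topology. -/
def Eid (n : ℕ) {M : Type*} [TopologicalSpace M]
    [ChartedSpace (EuclideanSpace ℝ (Fin n)) M] (Φ : Flow ℝ M) : Set C(M, M) :=
  pathComponentIn (E n Φ) (ContinuousMap.id M)

/-- The identity path component of `D(Φ)` in the compact-open topology. -/
def Did (n : ℕ) {M : Type*} [TopologicalSpace M]
    [ChartedSpace (EuclideanSpace ℝ (Fin n)) M] (Φ : Flow ℝ M) : Set C(M, M) :=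
  pathComponentIn (D n Φ) (ContinuousMap.id M)

/-- `Γ`: the smooth functions whose shift is a diffeomorphism. -/
def Gam (n : ℕ) {M : Type*} [TopologicalSpace M]
    [ChartedSpace (EuclideanSpace ℝ (Fin n)) M] (Φ : Flow ℝ M) :
    Set C^∞⟮𝓡 n, M; 𝓘(ℝ, ℝ), ℝ⟯ :=
  shift Φ ⁻¹' Diff n M

/-- `Γ⁺`: the `α ∈ Γ` with `dα(F(x)) > -1` for all `x`. -/
def GamPlus (n : ℕ) {M : Type*} [TopologicalSpace M]
    [ChartedSpace (EuclideanSpace ℝ (Fin n)) M] (Φ : Flow ℝ M) :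
    Set C^∞⟮𝓡 n, M; 𝓘(ℝ, ℝ), ℝ⟯ :=
  {α | α ∈ Gam n Φ ∧ ∀ x : M, (-1 : ℝ) < mfderiv (𝓡 n) 𝓘(ℝ, ℝ) α x (field n Φ x)}

/-- The open unit disk of dimension `k`; a single point for `k = 0`. -/
def disk (k : ℕ) : Set (EuclideanSpace ℝ (Fin k)) := Metric.ball 0 1

/-- The extension property with `k` parameters at a fixed point `z`: on some open neighbourhood
`V` of `z`, every smooth function `α` on `(V \ Fix Φ) × D^k` for which
`(x, τ) ↦ Φ(x, α(x, τ))` extends smoothly to `V × D^k` itself extends smoothly to `V × D^k`.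
Only the values of `α`, `h`, `β` on these sets matter. -/
def IsExtPoint (n k : ℕ) {M : Type*} [TopologicalSpace M]
    [ChartedSpace (EuclideanSpace ℝ (Fin n)) M] (Φ : Flow ℝ M) (z : M) : Prop :=
  z ∈ Fix Φ ∧ ∃ V : Set M, IsOpen V ∧ z ∈ V ∧
    ∀ α : M × EuclideanSpace ℝ (Fin k) → ℝ,
      ContMDiffOn ((𝓡 n).prod (𝓡 k)) 𝓘(ℝ, ℝ) ∞ α ((V \ Fix Φ) ×ˢ disk k) →
      (∃ h : M × EuclideanSpace ℝ (Fin k) → M,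
        ContMDiffOn ((𝓡 n).prod (𝓡 k)) (𝓡 n) ∞ h (V ×ˢ disk k) ∧
        EqOn h (fun p => Φ (α p) p.1) ((V \ Fix Φ) ×ˢ disk k)) →
      ∃ β : M × EuclideanSpace ℝ (Fin k) → ℝ,
        ContMDiffOn ((𝓡 n).prod (𝓡 k)) 𝓘(ℝ, ℝ) ∞ β (V ×ˢ disk k) ∧
        EqOn β α ((V \ Fix Φ) ×ˢ disk k)

end

end ShiftMap

/-! The scaling path `s ↦ Sh(sα)` joins the identity to `Sh(α)`. The derivative of `Sh(α)` at `x` is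
the derivative of the time-`α(x)` flow map composed with `v ↦ v + dα(v)F` (`tmap_shift`), so it is
invertible exactly when `dα(F) ≠ -1`. Since `F = 0` on `Fix Φ`, the path stays in `E(Φ)`. If `α ∈
Γ⁺`, each `t ↦ t + sα(Φ t x)` is strictly increasing, which makes `Sh(sα)` injective; surjectivity
passes from `α` to `sα` by the intermediate value theorem, so the path stays in `D(Φ)`.

Conversely, a path in `E(Φ)` moves every point inside its own trajectory. Off `Fix Φ` this motion
lifts, through flow boxes, to times `a(x, s)` with `a(x, 0) = 0` (`exists_lift`). The end time is
smooth there (`contMDiffAt_of_continuousAt`), and the extension property together with density of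
the complement of `Fix Φ` turns it into a global `α` (`exists_extension`). If the path lies in
`D(Φ)`, injectivity at each stage forbids `t + a(Φ t x, s) = a(x, s)` for small `t > 0`. Hence
`dα(F) ≥ -1`, and invertibility of the derivative excludes equality. -/

namespace ShiftMap

/-! ### Inverse function theorem on manifolds. -/

section InverseFunction

variable {E : Type*} [NormedAddCommGroup E] [NormedSpace ℝ E] [CompleteSpace E]

/-- Inverse function theorem for a map that is smooth on an open set. -/
theorem exists_openPartialHomeomorph_of_contDiffOn {F : Type*} [NormedAddCommGroup F]
    [NormedSpace ℝ F] {G : E → F} {U : Set E} (hU : IsOpen U) (hG : ContDiffOn ℝ ∞ G U) {a : E}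
    (ha : a ∈ U) {G' : E ≃L[ℝ] F} (hG' : HasFDerivAt G (G' : E →L[ℝ] F) a) :
    ∃ e : OpenPartialHomeomorph E F, a ∈ e.source ∧ e.source ⊆ U ∧ EqOn e G e.source ∧
      ContDiffOn ℝ ∞ e.symm e.target := by
  have hat : ∀ x ∈ U, ContDiffAt ℝ ∞ G x := fun x hx => hG.contDiffAt (hU.mem_nhds hx)
  -- Restricting to the open set where the derivative is invertible makes the local inverse smooth
  -- on its whole domain, not only at the image of `a`.
  let W : Set E := U ∩ fderiv ℝ G ⁻¹' range ((↑) : (E ≃L[ℝ] F) → E →L[ℝ] F)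
  have hW : IsOpen W :=
    (hG.continuousOn_fderiv_of_isOpen hU (by simp)).isOpen_inter_preimage hU
      ContinuousLinearEquiv.isOpen
  have haW : a ∈ W := ⟨ha, G', hG'.fderiv.symm⟩
  let e₀ := (hat a ha).toOpenPartialHomeomorph G hG' (by simp)
  have hs : (e₀.restrOpen W hW).source ⊆ W := fun x hx => hx.2
  refine ⟨e₀.restrOpen W hW,
    ⟨(hat a ha).mem_toOpenPartialHomeomorph_source hG' (by simp), haW⟩,
    fun x hx => (hs hx).1, fun x _ => rfl, fun y hy => ?_⟩
  have hx := (e₀.restrOpen W hW).map_target hy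
  obtain ⟨hxU, L, hL⟩ := hs hx
  refine ((e₀.restrOpen W hW).contDiffAt_symm hy (f₀' := L) ?_ (hat _ hxU)).contDiffWithinAt
  rw [hL]
  exact ((hat _ hxU).differentiableAt (by simp)).hasFDerivAt

/-- Inverse function theorem for manifolds without boundary. -/
theorem isLocalDiffeomorphAt_of_bijective_mfderiv {F : Type*} [NormedAddCommGroup F]
    [NormedSpace ℝ F] [CompleteSpace F]
    {M : Type*} [TopologicalSpace M] [ChartedSpace E M] [IsManifold 𝓘(ℝ, E) ∞ M]
    {N : Type*} [TopologicalSpace N] [ChartedSpace F N] [IsManifold 𝓘(ℝ, F) ∞ N]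
    {f : M → N} {U : Set M} (hU : IsOpen U) (hf : ContMDiffOn 𝓘(ℝ, E) 𝓘(ℝ, F) ∞ f U) {x : M}
    (hx : x ∈ U) (hb : Function.Bijective (mfderiv 𝓘(ℝ, E) 𝓘(ℝ, F) f x)) :
    IsLocalDiffeomorphAt 𝓘(ℝ, E) 𝓘(ℝ, F) ∞ f x := by
  have hfx : ContMDiffAt 𝓘(ℝ, E) 𝓘(ℝ, F) ∞ f x := hf.contMDiffAt (hU.mem_nhds hx)
  set φ := chartAt E x with hφ
  set ψ := chartAt F (f x) with hψ
  let U' : Set M := φ.source ∩ (U ∩ f ⁻¹' ψ.source)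
  have hU' : IsOpen U' :=
    φ.open_source.inter (hf.continuousOn.isOpen_inter_preimage hU ψ.open_source)
  have hxU' : x ∈ U' := ⟨mem_chart_source E x, hx, mem_chart_source F (f x)⟩
  let G : E → F := ψ ∘ f ∘ φ.symm
  let V : Set E := φ.target ∩ φ.symm ⁻¹' U'
  have hV : IsOpen V := φ.symm.isOpen_inter_preimage hU'
  have hG : ContDiffOn ℝ ∞ G V := by
    rw [← contMDiffOn_iff_contDiffOn]
    refine (contMDiffOn_chart (x := f x)).comp (hf.comp ((contMDiffOn_chart_symm (x := x)).mono
      inter_subset_left) ?_) ?_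
    · exact fun y hy => hy.2.2.1
    · exact fun y hy => hy.2.2.2
  have hmd := hfx.mdifferentiableAt (by simp)
  obtain ⟨A, hA, hG'⟩ : ∃ A : E →L[ℝ] F, Function.Bijective A ∧ HasFDerivAt G A (φ x) := by
    refine ⟨mfderiv 𝓘(ℝ, E) 𝓘(ℝ, F) f x, hb, ?_⟩
    have := hmd.hasMFDerivAt.2
    simp only [writtenInExtChartAt, extChartAt, OpenPartialHomeomorph.extend,
      modelWithCornersSelf_partialEquiv, PartialEquiv.trans_refl, modelWithCornersSelf_coe,
      range_id, OpenPartialHomeomorph.toFun_eq_coe, OpenPartialHomeomorph.coe_toPartialEquiv_symm]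
      at this
    exact hasFDerivWithinAt_univ.1 this
  let L : E ≃L[ℝ] F := ContinuousLinearEquiv.ofBijective A
    (LinearMap.ker_eq_bot.2 hA.1) (LinearMap.range_eq_top.2 hA.2)
  have haV : φ x ∈ V := ⟨φ.map_source hxU'.1, by
    simpa only [mem_preimage, φ.left_inv hxU'.1] using hxU'⟩
  obtain ⟨e, hae, heV, heG, hes⟩ := exists_openPartialHomeomorph_of_contDiffOn hV hG haV
    (G' := L) (by simpa only [L, ContinuousLinearEquiv.coe_ofBijective] using hG')
  let e' : OpenPartialHomeomorph M N := φ.trans (e.trans ψ.symm)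
  have hsrc : ∀ p ∈ e'.source, p ∈ U' ∧ e' p = f p := by
    intro p hp'
    have hp : p ∈ φ.source := hp'.1
    have hp1 : φ p ∈ e.source := hp'.2.1
    have hpV := heV hp1
    have hpU : p ∈ U' := by simpa only [mem_preimage, φ.left_inv hp] using hpV.2
    refine ⟨hpU, ?_⟩
    change ψ.symm (e (φ p)) = f p
    rw [heG hp1]
    change ψ.symm (ψ (f (φ.symm (φ p)))) = f p
    rw [φ.left_inv hp, ψ.left_inv hpU.2.2]
  have hxe' : x ∈ e'.source := by
    refine ⟨hxU'.1, hae, ?_⟩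
    change e (φ x) ∈ ψ.target
    rw [heG hae]
    change ψ (f (φ.symm (φ x))) ∈ _
    rw [φ.left_inv hxU'.1]
    exact ψ.map_source hxU'.2.2
  refine ⟨⟨e'.toPartialEquiv, e'.open_source, e'.open_target, ?_, ?_⟩, hxe',
    fun p hp => (hsrc p hp).2.symm⟩
  · exact (hf.mono fun p hp => (hsrc p hp).1.2.1).congr fun p hp => (hsrc p hp).2
  · change ContMDiffOn _ _ _ (φ.symm ∘ (e.symm ∘ ψ)) e'.target
    refine (contMDiffOn_chart_symm (x := x)).comp
      ((contMDiffOn_iff_contDiffOn.2 hes).comp ((contMDiffOn_chart (x := f x)).mono ?_) ?_) ?_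
    · exact fun q hq => hq.1.1
    · exact fun q hq => hq.1.2
    · exact fun q hq => hq.2

end InverseFunction

/-! ### Tangent maps as linear maps of model spaces. -/

section TangentMap

variable {E : Type*} [NormedAddCommGroup E] [NormedSpace ℝ E]
  {F : Type*} [NormedAddCommGroup F] [NormedSpace ℝ F]
  {K : Type*} [NormedAddCommGroup K] [NormedSpace ℝ K]
  {M : Type*} [TopologicalSpace M] [ChartedSpace E M]
  {N : Type*} [TopologicalSpace N] [ChartedSpace F N]
  {P : Type*} [TopologicalSpace P] [ChartedSpace K P]

variable (E F) in
/-- The manifold derivative, as a map between the model vector spaces. -/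
noncomputable def tmap (f : M → N) (x : M) : E →L[ℝ] F := mfderiv 𝓘(ℝ, E) 𝓘(ℝ, F) f x

theorem tmap_comp {g : N → P} {f : M → N} {x : M} {y : N}
    (hg : MDifferentiableAt 𝓘(ℝ, F) 𝓘(ℝ, K) g y) (hf : MDifferentiableAt 𝓘(ℝ, E) 𝓘(ℝ, F) f x)
    (hy : f x = y) (v : E) : tmap E K (fun z => g (f z)) x v = tmap F K g y (tmap E F f x v) := by
  subst hy
  have := mfderiv_comp x hg hf
  exact congrArg (fun A : E →L[ℝ] K => A v) this

theorem tmap_id (x : M) (v : E) : tmap E E (fun y : M => y) x v = v := by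
  have : mfderiv 𝓘(ℝ, E) 𝓘(ℝ, E) (id : M → M) x = _ := mfderiv_id
  exact congrArg (fun A : E →L[ℝ] E => A v) this

theorem tmap_const (x : M) (c : N) (v : E) : tmap E F (fun _ : M => c) x v = 0 := by
  have : mfderiv 𝓘(ℝ, E) 𝓘(ℝ, F) (fun _ : M => c) x = _ := mfderiv_const
  exact congrArg (fun A : E →L[ℝ] F => A v) this

theorem tmap_eq_fderiv (f : E → F) (x : E) : tmap E F f x = fderiv ℝ f x := mfderiv_eq_fderiv

theorem hasDerivAt_of_mdifferentiableAt {c : ℝ → F} {t : ℝ}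
    (hc : MDifferentiableAt 𝓘(ℝ, ℝ) 𝓘(ℝ, F) c t) : HasDerivAt c (tmap ℝ F c t (1 : ℝ)) t := by
  rw [tmap_eq_fderiv]
  exact (mdifferentiableAt_iff_differentiableAt.1 hc).hasFDerivAt.hasDerivAt

end TangentMap

/-- The model space of an `n`-dimensional manifold. -/
abbrev Eu (n : ℕ) : Type := EuclideanSpace ℝ (Fin n)


/-! ### Derivatives of the flow and zeros of its generating field. -/

section FlowDerivative

variable {n : ℕ} {M : Type*} [TopologicalSpace M] [ChartedSpace (Eu n) M]
  {Φ : Flow ℝ M}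

/-- The generating field, with values in the model space. -/
noncomputable def vfield (n : ℕ) {M : Type*} [TopologicalSpace M]
    [ChartedSpace (Eu n) M] (Φ : Flow ℝ M) (x : M) :
    Eu n := tmap ℝ (Eu n) (fun t : ℝ => Φ t x) 0 (1 : ℝ)

theorem IsSmoothFlow.mdifferentiableAt_curve (hΦ : IsSmoothFlow n Φ) (x : M) (t : ℝ) :
    MDifferentiableAt 𝓘(ℝ, ℝ) (𝓡 n) (fun s : ℝ => Φ s x) t :=
  (ContMDiff.comp (g := fun p : M × ℝ => Φ p.2 p.1) hΦ
    (contMDiff_const.prodMk contMDiff_id) t).mdifferentiableAt (by simp)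

theorem IsSmoothFlow.contMDiff_time (hΦ : IsSmoothFlow n Φ) (t : ℝ) :
    ContMDiff (𝓡 n) (𝓡 n) ∞ (Φ t) :=
  ContMDiff.comp (g := fun p : M × ℝ => Φ p.2 p.1) hΦ (contMDiff_id.prodMk contMDiff_const)

theorem IsSmoothFlow.mdifferentiableAt_time (hΦ : IsSmoothFlow n Φ) (t : ℝ) (x : M) :
    MDifferentiableAt (𝓡 n) (𝓡 n) (Φ t) x :=
  (hΦ.contMDiff_time t x).mdifferentiableAt (by simp)

theorem IsSmoothFlow.tmap_curve (hΦ : IsSmoothFlow n Φ) (x : M) (t : ℝ) :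
    tmap ℝ (Eu n) (fun s : ℝ => Φ s x) t (1 : ℝ) = vfield n Φ (Φ t x) := by
  have h1 : (fun s : ℝ => Φ s x) = fun s : ℝ => Φ (s - t) (Φ t x) := by
    funext s
    simp [← Φ.map_add]
  have h2 : HasDerivAt (fun s : ℝ => s - t) 1 t := (hasDerivAt_id t).sub_const t
  rw [h1, tmap_comp (g := fun s : ℝ => Φ s (Φ t x)) (hΦ.mdifferentiableAt_curve _ 0)
    h2.differentiableAt.mdifferentiableAt (sub_self t), tmap_eq_fderiv, h2.hasFDerivAt.fderiv]
  simp [vfield]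

/-- Differentiate `Φ s ∘ Φ t = Φ t ∘ Φ s` in `s` at `0`. -/
theorem IsSmoothFlow.tmap_time_vfield (hΦ : IsSmoothFlow n Φ) (x : M) (t : ℝ) :
    tmap (Eu n) (Eu n) (Φ t) x (vfield n Φ x) = vfield n Φ (Φ t x) := by
  have h1 : (fun s : ℝ => Φ s (Φ t x)) = fun s => Φ t (Φ s x) := by
    funext s
    simp [← Φ.map_add, add_comm]
  rw [vfield, vfield, h1, tmap_comp (hΦ.mdifferentiableAt_time t x)
    (hΦ.mdifferentiableAt_curve x 0) (Φ.map_zero_apply x)]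

theorem IsSmoothFlow.injective_tmap_time (hΦ : IsSmoothFlow n Φ) (x : M) (t : ℝ) :
    Function.Injective (tmap (Eu n) (Eu n) (Φ t) x) := by
  have h1 : (fun y => Φ (-t) (Φ t y)) = fun y => y := by
    funext y
    simp [← Φ.map_add]
  have h2 := tmap_comp (hΦ.mdifferentiableAt_time (-t) (Φ t x)) (hΦ.mdifferentiableAt_time t x) rfl
  simp only [h1, tmap_id] at h2
  intro v w hvw
  rw [h2 v, h2 w, hvw]

/-- The derivative of `x ↦ Φ (a x) (g x)`. -/
theorem IsSmoothFlow.tmap_comp_flow (hΦ : IsSmoothFlow n Φ) {F : Type*} [NormedAddCommGroup F]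
    [NormedSpace ℝ F] {N : Type*} [TopologicalSpace N] [ChartedSpace F N] {g : N → M} {a : N → ℝ}
    {x : N} (hg : MDifferentiableAt 𝓘(ℝ, F) (𝓡 n) g x)
    (ha : MDifferentiableAt 𝓘(ℝ, F) 𝓘(ℝ, ℝ) a x) (v : F) :
    tmap F (Eu n) (fun y => Φ (a y) (g y)) x v =
      tmap (Eu n) (Eu n) (Φ (a x)) (g x) (tmap F (Eu n) g x v) +
        tmap F ℝ a x v • vfield n Φ (Φ (a x) (g x)) := by
  have hd : MDifferentiableAt ((𝓡 n).prod 𝓘(ℝ, ℝ)) (𝓡 n) (fun p : M × ℝ => Φ p.2 p.1)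
      (g x, a x) := (hΦ _).mdifferentiableAt (by simp)
  have h1 := mfderiv_comp x hd (hg.prodMk ha)
  rw [mfderiv_prodMk hg ha] at h1
  rw [← hΦ.tmap_curve, ← ContinuousLinearMap.map_smul, smul_eq_mul, mul_one]
  refine (congrArg (fun A : F →L[ℝ] Eu n => A v) h1).trans ?_
  exact mfderiv_prod_eq_add_apply hd

/-- The derivative of `x ↦ Φ (a x) x` factors through the derivative of the flow. -/
theorem IsSmoothFlow.tmap_shift (hΦ : IsSmoothFlow n Φ) {a : M → ℝ} {x : M}
    (ha : MDifferentiableAt (𝓡 n) 𝓘(ℝ, ℝ) a x) (v : Eu n) :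
    tmap (Eu n) (Eu n) (fun y => Φ (a y) y) x v = tmap (Eu n) (Eu n) (Φ (a x)) x (v + tmap (Eu n) ℝ a x v • vfield n Φ x) := by
  rw [hΦ.tmap_comp_flow (g := fun y : M => y) mdifferentiableAt_id ha v,
    ContinuousLinearMap.map_add, ContinuousLinearMap.map_smul, hΦ.tmap_time_vfield, tmap_id]

theorem vfield_eq_zero_of_mem_Fix {x : M} (hx : x ∈ Fix Φ) : vfield n Φ x = 0 := by
  have h : (fun t : ℝ => Φ t x) = fun _ => x := funext hx
  rw [vfield, h, tmap_const]

/-- The derivative of a map along a trajectory. -/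
theorem IsSmoothFlow.hasDerivAt_comp_curve (hΦ : IsSmoothFlow n Φ) {F : Type*}
    [NormedAddCommGroup F] [NormedSpace ℝ F] {a : M → F} {x : M} {t : ℝ}
    (ha : MDifferentiableAt (𝓡 n) 𝓘(ℝ, F) a (Φ t x)) :
    HasDerivAt (fun s => a (Φ s x)) (tmap (Eu n) F a (Φ t x) (vfield n Φ (Φ t x))) t := by
  have hc := ha.comp t (hΦ.mdifferentiableAt_curve x t)
  rw [← hΦ.tmap_curve, ← tmap_comp ha (hΦ.mdifferentiableAt_curve x t) rfl]
  exact hasDerivAt_of_mdifferentiableAt hc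

/-- A point where the generating field vanishes is fixed by the flow. -/
theorem IsSmoothFlow.mem_Fix_of_vfield_eq_zero [IsManifold (𝓡 n) ∞ M]
    (hΦ : IsSmoothFlow n Φ) {x : M} (hx : vfield n Φ x = 0) : x ∈ Fix Φ := by
  have hc : Continuous fun t : ℝ => Φ t x := Φ.continuous continuous_id continuous_const
  have h0 : ∀ t, vfield n Φ (Φ t x) = 0 := fun t => by
    rw [← hΦ.tmap_time_vfield, hx, ContinuousLinearMap.map_zero]
  -- The field vanishes along the whole trajectory, so in a chart the curve has zero derivative.
  have hloc : IsLocallyConstant fun t : ℝ => Φ t x := by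
    rw [IsLocallyConstant.iff_eventually_eq]
    intro t
    set φ := chartAt (Eu n) (Φ t x) with hφ
    obtain ⟨ε, hε, hball⟩ := Metric.isOpen_iff.1 (φ.open_source.preimage hc) t
      (mem_chart_source _ (Φ t x))
    have hder : ∀ s ∈ Metric.ball t ε, HasDerivAt (fun r => φ (Φ r x)) 0 s := by
      intro s hs
      have hmd : MDifferentiableAt (𝓡 n) (𝓡 n) φ (Φ s x) :=
        (contMDiffAt_of_mem_maximalAtlas (n := ∞) (IsManifold.chart_mem_maximalAtlas _)
          (hball hs)).mdifferentiableAt (by simp)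
      simpa [h0] using hΦ.hasDerivAt_comp_curve hmd
    filter_upwards [Metric.ball_mem_nhds t hε] with s hs
    refine φ.injOn (hball hs) (hball (Metric.mem_ball_self hε)) ?_
    exact Metric.isOpen_ball.is_const_of_deriv_eq_zero (convex_ball t ε).isPreconnected
      (fun r hr => (hder r hr).differentiableAt.differentiableWithinAt)
      (fun r hr => (hder r hr).deriv) hs (Metric.mem_ball_self hε)
  intro t
  rw [hloc.apply_eq_of_isPreconnected isPreconnected_univ (mem_univ t) (mem_univ 0)]
  exact Φ.map_zero_apply x

end FlowDerivative

/-! ### Flow boxes around points that are not fixed. -/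

section FlowBox

variable {n : ℕ} {M : Type*} [TopologicalSpace M] [ChartedSpace (EuclideanSpace ℝ (Fin n)) M]
  {Φ : Flow ℝ M}

/-- `τ` is the time coordinate, with range `(-ε, ε)`, of a flow box with domain `N`. -/
structure IsFlowBox (n : ℕ) {M : Type*} [TopologicalSpace M] [ChartedSpace (Eu n) M]
    (Φ : Flow ℝ M) (N : Set M) (τ : M → ℝ) (ε : ℝ) : Prop where
  isOpen : IsOpen N
  pos : 0 < ε
  contMDiffOn : ContMDiffOn (𝓡 n) 𝓘(ℝ, ℝ) ∞ τ N
  abs_lt : ∀ p ∈ N, |τ p| < ε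
  mem : ∀ p ∈ N, ∀ t, |τ p + t| < ε → Φ t p ∈ N
  time : ∀ p ∈ N, ∀ t, |τ p + t| < ε → τ (Φ t p) = τ p + t

/-- Flowing a hyperplane transverse to the field gives a local diffeomorphism in which the flow is a
translation; `τ` is the coordinate in the direction of translation. -/
theorem IsSmoothFlow.exists_isFlowBox [IsManifold (𝓡 n) ∞ M]
    (hΦ : IsSmoothFlow n Φ) {y : M} (hy : y ∉ Fix Φ) :
    ∃ N τ ε, IsFlowBox n Φ N τ ε ∧ y ∈ N := by
  have hF : vfield n Φ y ≠ 0 := fun h => hy (hΦ.mem_Fix_of_vfield_eq_zero h)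
  set φ := chartAt (Eu n) y with hφ
  set a := φ y with ha
  have hyφ : y ∈ φ.source := mem_chart_source _ y
  have haφ : a ∈ φ.target := φ.map_source hyφ
  have hga : φ.symm a = y := φ.left_inv hyφ
  have hgs : ContMDiffOn (𝓡 n) (𝓡 n) ∞ φ.symm φ.target := contMDiffOn_chart_symm
  have hgd : MDifferentiableAt (𝓡 n) (𝓡 n) φ.symm a :=
    (hgs.contMDiffAt (φ.open_target.mem_nhds haφ)).mdifferentiableAt (by simp)
  have hgb : Function.Bijective (tmap (Eu n) (Eu n) φ.symm a) :=
    (mdifferentiable_chart (I := 𝓡 n) y).symm.mfderiv_bijective haφ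
  obtain ⟨e, he⟩ := hgb.2 (vfield n Φ y)
  have he0 : e ≠ 0 := by
    rintro rfl
    rw [ContinuousLinearMap.map_zero] at he
    exact hF he.symm
  obtain ⟨l, hl⟩ := SeparatingDual.exists_eq_one (R := ℝ) he0
  -- `c` is the coordinate of `v - a` along `e`, and `w` projects along `e` to the hyperplane `c =
  -- 0` through `a`.
  let c : Eu n → ℝ := fun v => l (v - a)
  let w : Eu n → Eu n := fun v => v - c v • e
  have hcs : ContDiff ℝ ∞ c := l.contDiff.comp (contDiff_id.sub contDiff_const)
  have hws : ContDiff ℝ ∞ w := contDiff_id.sub (hcs.smul contDiff_const)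
  have hca : c a = 0 := by simp [c]
  have hwa : w a = a := by simp [w, hca]
  let Ψ : Eu n → M := fun v => Φ (c v) (φ.symm (w v))
  let U : Set (Eu n) := w ⁻¹' φ.target
  have hU : IsOpen U := φ.open_target.preimage hws.continuous
  have haU : a ∈ U := by simpa [U, hwa] using haφ
  have hΨ : ContMDiffOn (𝓡 n) (𝓡 n) ∞ Ψ U :=
    ContMDiff.comp_contMDiffOn (g := fun p : M × ℝ => Φ p.2 p.1) hΦ
      ((hgs.comp hws.contMDiff.contMDiffOn fun v hv => hv).prodMk hcs.contMDiff.contMDiffOn)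
  have hc' : HasFDerivAt c l a := l.hasFDerivAt.comp a ((hasFDerivAt_id a).sub_const a)
  have hw' : HasFDerivAt w (ContinuousLinearMap.id ℝ (Eu n) - l.smulRight e) a :=
    (hasFDerivAt_id a).sub (hc'.smul_const e)
  have hΨ' : ∀ v, tmap (Eu n) (Eu n) Ψ a v = tmap (Eu n) (Eu n) φ.symm a v := by
    intro v
    have hwd : MDifferentiableAt (𝓡 n) (𝓡 n) w a := hw'.differentiableAt.mdifferentiableAt
    have hcd : MDifferentiableAt (𝓡 n) 𝓘(ℝ, ℝ) c a := hc'.differentiableAt.mdifferentiableAt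
    have h1 : MDifferentiableAt (𝓡 n) (𝓡 n) (fun u => φ.symm (w u)) a :=
      MDifferentiableAt.comp (g := φ.symm) a (by rwa [hwa]) hwd
    have h0 : Φ 0 = fun x : M => x := funext Φ.map_zero_apply
    rw [hΦ.tmap_comp_flow h1 hcd v, tmap_comp hgd hwd hwa, tmap_eq_fderiv w, hw'.fderiv,
      tmap_eq_fderiv c, hc'.fderiv, hca, hwa, hga, h0, tmap_id, ← he,
      ← ContinuousLinearMap.map_smul, ← ContinuousLinearMap.map_add]
    simp
  have hloc : IsLocalDiffeomorphAt (𝓡 n) (𝓡 n) ∞ Ψ a := by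
    refine isLocalDiffeomorphAt_of_bijective_mfderiv hU hΨ haU ?_
    have h2 : tmap (Eu n) (Eu n) Ψ a = tmap (Eu n) (Eu n) φ.symm a := ContinuousLinearMap.ext hΨ'
    change Function.Bijective (tmap (Eu n) (Eu n) Ψ a)
    rw [h2]
    exact hgb
  obtain ⟨P, haP, hPΨ⟩ := hloc
  obtain ⟨δ, hδ, hball⟩ := Metric.isOpen_iff.1 P.open_source a haP
  -- With this bound on `|c v|`, the displacement `c v • e` is shorter than `δ / 2`, which leaves `δ
  -- / 2` for `w v - a`.
  have hε : 0 < δ / (2 * (‖e‖ + 1)) := by positivity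
  set ε := δ / (2 * (‖e‖ + 1)) with hεdef
  let Q : Set (Eu n) := {v | |c v| < ε} ∩ w ⁻¹' Metric.ball a (δ / 2)
  have hQ : IsOpen Q := (isOpen_lt hcs.continuous.abs continuous_const).inter
    (Metric.isOpen_ball.preimage hws.continuous)
  have hQP : Q ⊆ P.source := by
    rintro v ⟨hv1, hv2⟩
    refine hball ?_
    have hv1' : |c v| < ε := hv1
    have hv2' : ‖w v - a‖ < δ / 2 := by simpa [dist_eq_norm] using hv2
    have h3 : v - a = (w v - a) + c v • e := by
      simp only [w]
      abel
    have h4 : ε * (‖e‖ + 1) = δ / 2 := by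
      rw [hεdef]
      field_simp
    rw [mem_ball_iff_norm, h3]
    calc ‖(w v - a) + c v • e‖ ≤ ‖w v - a‖ + |c v| * ‖e‖ := by
          simpa [norm_smul] using norm_add_le (w v - a) (c v • e)
      _ ≤ ‖w v - a‖ + ε * (‖e‖ + 1) := by
          gcongr
          linarith
      _ < δ := by linarith
  have hshift : ∀ (v : Eu n) (t : ℝ), c (v + t • e) = c v + t := fun v t => by
    simp only [c, add_sub_right_comm, map_add, map_smul, hl, smul_eq_mul, mul_one]
  have hwshift : ∀ (v : Eu n) (t : ℝ), w (v + t • e) = w v := fun v t => by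
    simp only [w, hshift, add_smul]
    abel
  have key : ∀ p ∈ P.target ∩ P.symm ⁻¹' Q, ∀ t, |c (P.symm p) + t| < ε →
      Φ t p ∈ P.target ∧ P.symm (Φ t p) = P.symm p + t • e ∧ P.symm p + t • e ∈ Q := by
    rintro p ⟨hp, hpQ⟩ t ht
    have hq : P.symm p + t • e ∈ Q := by
      refine ⟨?_, ?_⟩
      · simpa only [mem_ofPred_eq, hshift] using ht
      · simpa only [mem_preimage, hwshift] using hpQ.2
    have hpv : Ψ (P.symm p) = p := (hPΨ (P.map_target hp)).trans (P.right_inv hp)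
    have hΨt : Φ t p = P (P.symm p + t • e) := by
      rw [← hPΨ (hQP hq)]
      change _ = Φ (c (P.symm p + t • e)) (φ.symm (w (P.symm p + t • e)))
      rw [hshift, hwshift, add_comm, Φ.map_add]
      exact congrArg (Φ t) hpv.symm
    rw [hΨt]
    exact ⟨P.map_source (hQP hq), P.left_inv (hQP hq), hq⟩
  refine ⟨P.target ∩ P.symm ⁻¹' Q, fun p => c (P.symm p), ε, ⟨?_, hε, ?_, ?_, ?_, ?_⟩, ?_⟩
  · exact P.symm.contMDiffOn.continuousOn.isOpen_inter_preimage P.open_target hQ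
  · exact hcs.contMDiff.comp_contMDiffOn (P.symm.contMDiffOn.mono inter_subset_left)
  · exact fun p hp => hp.2.1
  · intro p hp t ht
    obtain ⟨h1, h2, h3⟩ := key p hp t ht
    exact ⟨h1, by simpa only [mem_preimage, h2] using h3⟩
  · intro p hp t ht
    obtain ⟨h1, h2, h3⟩ := key p hp t ht
    simp only [h2, hshift]
  · have hya : P a = y := by
      rw [← hPΨ haP]
      simp [Ψ, hca, hwa, hga]
    have hPy : P.symm y = a := by
      rw [← hya]
      exact P.left_inv haP
    refine ⟨?_, ?_⟩
    · rw [← hya]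
      exact P.map_source haP
    · simp only [mem_preimage, hPy]
      exact ⟨by simpa [hca] using hε, by simpa [hwa] using hδ⟩

end FlowBox

/-! ### Lifting homotopies along trajectories to times. -/

section Lifting

open scoped unitInterval

variable {n : ℕ} {M : Type*} [TopologicalSpace M] [ChartedSpace (EuclideanSpace ℝ (Fin n)) M]
  {Φ : Flow ℝ M} {N : Set M} {τ : M → ℝ} {ε : ℝ}

/-- A trajectory crosses the zero section of a flow box countably often. -/
theorem IsFlowBox.countable_crossing (hN : IsFlowBox n Φ N τ ε) (x : M) :
    {t : ℝ | Φ t x ∈ N ∧ τ (Φ t x) = 0}.Countable := by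
  -- Two crossings less than `ε` apart coincide, so each interval `[kε, (k+1)ε)` contains at most
  -- one.
  refine MapsTo.countable_of_injOn (f := fun t : ℝ => ⌊t / ε⌋) (mapsTo_univ _ _) ?_
    (to_countable univ)
  rintro t ⟨ht, ht0⟩ t' ⟨ht', ht0'⟩ h
  have h1 := Int.abs_sub_lt_one_of_floor_eq_floor h
  have h2 : |t' - t| < ε := by
    rwa [← sub_div, abs_div, abs_of_pos hN.pos, div_lt_one hN.pos, abs_sub_comm] at h1
  have h3 := hN.time _ ht (t' - t) (by rwa [ht0, zero_add])
  rw [← Φ.map_add, sub_add_cancel, ht0, ht0', zero_add] at h3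
  linarith

/-- Along a connected subset of a trajectory inside a flow box, the time coordinate measures the
time needed to pass from one point to another. -/
theorem IsFlowBox.eq_of_isPreconnected [TopologicalSpace.MetrizableSpace M]
    (hN : IsFlowBox n Φ N τ ε) {x : M} {S : Set M} (hS : IsPreconnected S) (hSN : S ⊆ N)
    (hSx : S ⊆ Φ.orbit x) {p q : M} (hp : p ∈ S) (hq : q ∈ S) : Φ (τ q - τ p) p = q := by
  let := TopologicalSpace.metrizableSpaceMetric M
  -- `ρ` slides points to the zero section. On `S` its image is connected and countable, hence a
  -- single point, even if the trajectory returns to the box many times.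
  let ρ : M → M := fun p => Φ (-τ p) p
  have hρ : ContinuousOn ρ S := by
    have h1 : ContinuousOn (fun p => (-τ p, p)) S :=
      ((hN.contMDiffOn.continuousOn.mono hSN).neg).prodMk continuousOn_id
    exact Φ.cont'.comp_continuousOn h1
  have hcount : (ρ '' S).Countable := by
    refine ((hN.countable_crossing x).image fun t => Φ t x).mono ?_
    rintro _ ⟨r, hr, rfl⟩
    obtain ⟨t, rfl⟩ := hSx hr
    have h0 : |τ (Φ t x) + -τ (Φ t x)| < ε := by simpa using hN.pos
    have h1 := hN.mem _ (hSN hr) _ h0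
    have h2 := hN.time _ (hSN hr) _ h0
    refine ⟨-τ (Φ t x) + t, ?_, ?_⟩
    · simp only [mem_ofPred_eq, Φ.map_add]
      exact ⟨h1, h2.trans (add_neg_cancel _)⟩
    · exact Φ.map_add _ _ _
  have heq : ρ q = ρ p := hcount.isTotallyDisconnected _ Subset.rfl (hS.image ρ hρ)
    (mem_image_of_mem ρ hq) (mem_image_of_mem ρ hp)
  rw [sub_eq_add_neg, Φ.map_add]
  change Φ (τ q) (ρ p) = q
  rw [← heq]
  simp [ρ, ← Φ.map_add]

theorem IsFlowBox.exists_time_ne (hN : IsFlowBox n Φ N τ ε) {x : M} (hx : x ∈ N) :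
    ∃ δ > 0, ∀ t, |t| < δ → Φ t x = x → t = 0 := by
  refine ⟨ε - |τ x|, sub_pos.2 (hN.abs_lt x hx), fun t ht htx => ?_⟩
  have h := hN.time x hx t ((abs_add_le _ _).trans_lt (by linarith))
  rw [htx] at h
  linarith

theorem flow_notMem_Fix {x : M} (hx : x ∉ Fix Φ) (t : ℝ) : Φ t x ∉ Fix Φ := by
  intro h
  refine hx fun s => ?_
  have h1 := h (-t)
  have h2 := h (s - t)
  rw [← Φ.map_add, neg_add_cancel, Φ.map_zero_apply] at h1
  rw [← Φ.map_add, sub_add_cancel] at h2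
  rw [h2, ← h1]

theorem flow_sub_eq_of_eq {x : M} {s t : ℝ} (h : Φ s x = Φ t x) : Φ (s - t) x = x := by
  rw [sub_eq_neg_add, Φ.map_add, h, ← Φ.map_add, neg_add_cancel, Φ.map_zero_apply]

theorem isClosed_Fix [T2Space M] : IsClosed (Fix Φ) := by
  have h : Fix Φ = ⋂ t : ℝ, {x | Φ t x = x} := by
    ext
    simp [Fix]
  rw [h]
  exact isClosed_iInter fun t => isClosed_eq (Φ.continuous_toFun t) continuous_id

variable [IsManifold (𝓡 n) ∞ M]

/-- The periods of a point that is not fixed are isolated. -/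
theorem IsSmoothFlow.exists_period_bound (hΦ : IsSmoothFlow n Φ) {x : M} (hx : x ∉ Fix Φ) :
    ∃ δ > 0, ∀ t, |t| < δ → Φ t x = x → t = 0 := by
  obtain ⟨N, τ, ε, hN, hxN⟩ := hΦ.exists_isFlowBox hx
  exact hN.exists_time_ne hxN

/-- Continuous time lifts of a curve in a trajectory are determined by their initial value. -/
theorem IsSmoothFlow.lift_unique (hΦ : IsSmoothFlow n Φ) {x : M} (hx : x ∉ Fix Φ) {a b : I → ℝ}
    (ha : Continuous a) (hb : Continuous b) (hab : ∀ s, Φ (a s) x = Φ (b s) x)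
    (h0 : a 0 = b 0) : a = b := by
  obtain ⟨δ, hδ, hper⟩ := hΦ.exists_period_bound hx
  have hd : Continuous fun s => a s - b s := ha.sub hb
  -- The difference of two lifts is always a period of `x`, and periods are isolated.
  have hloc : IsLocallyConstant fun s => a s - b s := by
    rw [IsLocallyConstant.iff_eventually_eq]
    intro s
    filter_upwards [hd.continuousAt.eventually (Metric.ball_mem_nhds _ hδ)] with r hr
    have h1 := flow_sub_eq_of_eq (hab r)
    have h2 := flow_sub_eq_of_eq (hab s)
    have h3 : Φ ((a r - b r) - (a s - b s)) x = x := flow_sub_eq_of_eq (h1.trans h2.symm)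
    exact sub_eq_zero.1 (hper _ (by rwa [← Real.dist_eq]) h3)
  funext s
  have h1 : a s - b s = a 0 - b 0 :=
    hloc.apply_eq_of_isPreconnected isPreconnected_univ (mem_univ s) (mem_univ 0)
  rw [h0, sub_self] at h1
  exact sub_eq_zero.1 h1

/-- A homotopy along trajectories lifts to times, locally near a point that is not fixed. -/
theorem IsSmoothFlow.exists_local_lift [TopologicalSpace.MetrizableSpace M]
    (hΦ : IsSmoothFlow n Φ) {H : M × I → M} (hH : Continuous H) (hH0 : ∀ x, H (x, 0) = x)
    (hHo : ∀ x s, H (x, s) ∈ Φ.orbit x) {x₀ : M} (hx₀ : x₀ ∉ Fix Φ) :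
    ∃ U ∈ 𝓝 x₀, ∃ a : M × I → ℝ, ContinuousOn a (U ×ˢ univ) ∧
      ∀ x ∈ U, a (x, 0) = 0 ∧ ∀ s, Φ (a (x, s)) x = H (x, s) := by
  have hbox : ∀ s : I, ∃ (N : Set M) (τ : M → ℝ) (ε : ℝ) (U : Set M) (J : Set I),
      IsFlowBox n Φ N τ ε ∧ U ∈ 𝓝 x₀ ∧ IsOpen J ∧ s ∈ J ∧ ∀ x ∈ U, ∀ r ∈ J, H (x, r) ∈ N := by
    intro s
    have hs : H (x₀, s) ∉ Fix Φ := by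
      obtain ⟨t, ht⟩ := hHo x₀ s
      rw [← ht]
      exact flow_notMem_Fix hx₀ t
    obtain ⟨N, τ, ε, hN, hsN⟩ := hΦ.exists_isFlowBox hs
    obtain ⟨U, J, hU, hxU, hJ, hsJ, hUJ⟩ :=
      mem_nhds_prod_iff'.1 ((hN.isOpen.preimage hH).mem_nhds hsN)
    exact ⟨N, τ, ε, U, J, hN, hU.mem_nhds hxU, hJ, hsJ, fun x hx r hr => hUJ ⟨hx, hr⟩⟩
  choose N τ ε U J hN hU hJ hsJ hmem using hbox
  obtain ⟨t, ht0, htmono, ⟨m, htm⟩, htJ⟩ := exists_monotone_Icc_subset_open_cover_unitInterval hJ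
    (fun s _ => mem_iUnion.2 ⟨s, hsJ s⟩)
  have hstep : ∀ k, ∃ V ∈ 𝓝 x₀, ∃ a : M × I → ℝ, ContinuousOn a (V ×ˢ univ) ∧
      ∀ x ∈ V, a (x, 0) = 0 ∧ ∀ s ≤ t k, Φ (a (x, s)) x = H (x, s) := by
    intro k
    induction k with
    | zero =>
      refine ⟨univ, Filter.univ_mem, fun _ => 0, continuousOn_const, fun x _ => ⟨rfl, fun s hs => ?_⟩⟩
      rw [ht0] at hs
      rw [le_antisymm hs bot_le, Φ.map_zero_apply]
      exact (hH0 x).symm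
    | succ k ih =>
      obtain ⟨V, hV, a, ha, haV⟩ := ih
      obtain ⟨i, hi⟩ := htJ k
      have hk : t k ≤ t (k + 1) := htmono k.le_succ
      -- Clamping to the current interval keeps the arguments of `τ i` inside the box for every `s`
      -- and makes the correction term vanish for `s ≤ t k`.
      let cl : I → I := fun s => max (t k) (min s (t (k + 1)))
      have hcl : Continuous cl := continuous_const.max (continuous_id.min continuous_const)
      have hclm : ∀ s, cl s ∈ Icc (t k) (t (k + 1)) :=
        fun s => ⟨le_max_left _ _, max_le hk (min_le_right _ _)⟩
      have hcl1 : ∀ s ≤ t k, cl s = t k := fun s hs => max_eq_left ((min_le_left _ _).trans hs)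
      refine ⟨V ∩ U i, Filter.inter_mem hV (hU i), fun p => a (p.1, min p.2 (t k)) +
        (τ i (H (p.1, cl p.2)) - τ i (H (p.1, t k))), ?_, ?_⟩
      · have h1 : ContinuousOn (fun p : M × I => a (p.1, min p.2 (t k))) ((V ∩ U i) ×ˢ univ) :=
          ha.comp (Continuous.continuousOn (by fun_prop)) fun p hp => ⟨hp.1.1, mem_univ _⟩
        have h2 : ∀ c : I → I, Continuous c → (∀ s, c s ∈ Icc (t k) (t (k + 1))) →
            ContinuousOn (fun p : M × I => τ i (H (p.1, c p.2))) ((V ∩ U i) ×ˢ univ) :=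
          fun c hc hcm => (hN i).contMDiffOn.continuousOn.comp
            (Continuous.continuousOn (by fun_prop))
            fun p hp => hmem i _ hp.1.2 _ (hi (hcm _))
        exact h1.add ((h2 cl hcl hclm).sub
          (h2 (fun _ => t k) continuous_const fun _ => ⟨le_rfl, hk⟩))
      · rintro x ⟨hxV, hxU⟩
        obtain ⟨hx0, hxs⟩ := haV x hxV
        have hle : ∀ s ≤ t k, a (x, min s (t k)) + (τ i (H (x, cl s)) - τ i (H (x, t k))) =
            a (x, s) := fun s hs => by rw [hcl1 s hs, sub_self, add_zero, min_eq_left hs]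
        refine ⟨(hle 0 bot_le).trans hx0, fun s hs => ?_⟩
        rcases le_total s (t k) with hsk | hsk
        · exact (congrArg (fun r => Φ r x) (hle s hsk)).trans (hxs s hsk)
        · have hcs : cl s = s := by simp only [cl, min_eq_left hs, max_eq_right hsk]
          simp only [min_eq_right hsk, hcs]
          rw [add_comm, Φ.map_add, hxs _ le_rfl]
          refine (hN i).eq_of_isPreconnected (x := x)
            (S := (fun r => H (x, r)) '' Icc (t k) (t (k + 1))) ?_ ?_ ?_ ?_ ?_
          · exact isPreconnected_Icc.image _ (Continuous.continuousOn (by fun_prop))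
          · rintro _ ⟨r, hr, rfl⟩
            exact hmem i x hxU r (hi hr)
          · rintro _ ⟨r, hr, rfl⟩
            exact hHo x r
          · exact ⟨_, ⟨le_rfl, hk⟩, rfl⟩
          · exact ⟨_, ⟨hsk, hs⟩, rfl⟩
  obtain ⟨V, hV, a, ha, haV⟩ := hstep m
  refine ⟨V, hV, a, ha, fun x hx => ⟨(haV x hx).1, fun s => (haV x hx).2 s ?_⟩⟩
  rw [htm m le_rfl]
  exact le_top

/-- A homotopy along trajectories lifts to times off the fixed-point set. -/
theorem IsSmoothFlow.exists_lift [T2Space M] [TopologicalSpace.MetrizableSpace M]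
    (hΦ : IsSmoothFlow n Φ) {H : M × I → M} (hH : Continuous H) (hH0 : ∀ x, H (x, 0) = x)
    (hHo : ∀ x s, H (x, s) ∈ Φ.orbit x) :
    ∃ a : M → I → ℝ, ∀ x ∉ Fix Φ, Continuous (a x) ∧ a x 0 = 0 ∧
      (∀ s, Φ (a x s) x = H (x, s)) ∧ ∀ s, ContinuousAt (fun y => a y s) x := by
  have hloc : ∀ x, ∃ U, ∃ a : M × I → ℝ, x ∉ Fix Φ → (U ∈ 𝓝 x ∧ ContinuousOn a (U ×ˢ univ) ∧
      ∀ y ∈ U, a (y, 0) = 0 ∧ ∀ s, Φ (a (y, s)) y = H (y, s)) := by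
    intro x
    by_cases hx : x ∈ Fix Φ
    · exact ⟨∅, 0, fun h => absurd hx h⟩
    · obtain ⟨U, hU, a, ha⟩ := hΦ.exists_local_lift hH hH0 hHo hx
      exact ⟨U, a, fun _ => ⟨hU, ha⟩⟩
  choose U a ha using hloc
  have hcont : ∀ x ∉ Fix Φ, ∀ y ∈ U x, Continuous fun s => a x (y, s) := fun x hx y hy =>
    (ha x hx).2.1.comp_continuous (by fun_prop) fun s => ⟨hy, mem_univ s⟩
  have hself : ∀ x ∉ Fix Φ, x ∈ U x := fun x hx => mem_of_mem_nhds (ha x hx).1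
  have heq : ∀ x ∉ Fix Φ, ∀ y ∉ Fix Φ, y ∈ U x → ∀ s, a y (y, s) = a x (y, s) := by
    intro x hx y hy hyU
    obtain ⟨h1, h2⟩ := (ha y hy).2.2 y (hself y hy)
    obtain ⟨h3, h4⟩ := (ha x hx).2.2 y hyU
    exact congrFun (hΦ.lift_unique hy (hcont y hy y (hself y hy)) (hcont x hx y hyU)
      (fun s => (h2 s).trans (h4 s).symm) (h1.trans h3.symm))
  -- Each point uses the local lift based at itself; by `heq` these values agree near `x` with the
  -- single lift `a x`, which gives continuity.
  refine ⟨fun x s => a x (x, s), fun x hx => ⟨hcont x hx x (hself x hx),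
    ((ha x hx).2.2 x (hself x hx)).1, ((ha x hx).2.2 x (hself x hx)).2, fun s => ?_⟩⟩
  have h1 : ContinuousAt (fun y => a x (y, s)) x := by
    have h2 : ContinuousAt (a x) (x, s) :=
      (ha x hx).2.1.continuousAt (prod_mem_nhds (ha x hx).1 Filter.univ_mem)
    exact ContinuousAt.comp (f := fun y => (y, s)) h2 (by fun_prop)
  refine h1.congr ?_
  filter_upwards [(ha x hx).1, isClosed_Fix.isOpen_compl.mem_nhds hx] with y hy hyF
  exact (heq x hx y hyF hy s).symm

/-- A continuous time function of a smooth map along trajectories is smooth. -/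
theorem IsSmoothFlow.contMDiffAt_of_continuousAt (hΦ : IsSmoothFlow n Φ) {f : M → M} {a : M → ℝ}
    {x : M} (hx : x ∉ Fix Φ) (hf : ContMDiffAt (𝓡 n) (𝓡 n) ∞ f x) (ha : ContinuousAt a x)
    (haf : ∀ᶠ y in 𝓝 x, Φ (a y) y = f y) : ContMDiffAt (𝓡 n) 𝓘(ℝ, ℝ) ∞ a x := by
  have hfx : Φ (a x) x = f x := haf.self_of_nhds
  obtain ⟨N, τ, ε, hN, hxN⟩ := hΦ.exists_isFlowBox (flow_notMem_Fix hx (a x))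
  have hτ : ContMDiffAt (𝓡 n) 𝓘(ℝ, ℝ) ∞ τ (Φ (a x) x) :=
    hN.contMDiffOn.contMDiffAt (hN.isOpen.mem_nhds hxN)
  have hg := hΦ.contMDiff_time (a x) x
  have hτg : ContMDiffAt (𝓡 n) 𝓘(ℝ, ℝ) ∞ (fun y => τ (Φ (a x) y)) x := hτ.comp x hg
  have hτf : ContMDiffAt (𝓡 n) 𝓘(ℝ, ℝ) ∞ (fun y => τ (f y)) x :=
    ContMDiffAt.comp (g := τ) x (by rwa [← hfx]) hf
  -- Near `x`, `a y - a x` is the time from `Φ (a x) y` to `f y`, and both points lie in one box,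
  -- where `τ` measures it.
  have hsmooth : ContMDiffAt (𝓡 n) 𝓘(ℝ, ℝ) ∞ (fun y => τ (f y) - τ (Φ (a x) y) + a x) x :=
    (hτf.sub hτg).add contMDiffAt_const
  refine hsmooth.congr_of_eventuallyEq ?_
  have hlt : ∀ᶠ y in 𝓝 x, |τ (Φ (a x) y) + (a y - a x)| < ε := by
    have hc : ContinuousAt (fun y => |τ (Φ (a x) y) + (a y - a x)|) x :=
      (hτg.continuousAt.add (ha.sub continuousAt_const)).abs
    refine hc.eventually_lt continuousAt_const ?_
    simpa using hN.abs_lt _ hxN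
  filter_upwards [haf, hlt, hg.continuousAt.eventually (hN.isOpen.mem_nhds hxN)] with y hy hyt hyN
  have h := hN.time _ hyN _ hyt
  rw [← Φ.map_add, sub_add_cancel, hy] at h
  rw [h]
  ring

end Lifting

/-! ### Shift maps and the path components of the identity. -/

section Shift

open scoped unitInterval

variable {n : ℕ} {M : Type*} [TopologicalSpace M] [ChartedSpace (EuclideanSpace ℝ (Fin n)) M]
  {Φ : Flow ℝ M}

theorem IsSmoothFlow.contMDiff_shift (hΦ : IsSmoothFlow n Φ) {a : M → ℝ}
    (ha : ContMDiff (𝓡 n) 𝓘(ℝ, ℝ) ∞ a) : ContMDiff (𝓡 n) (𝓡 n) ∞ fun x => Φ (a x) x :=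
  ContMDiff.comp (g := fun p : M × ℝ => Φ p.2 p.1) hΦ (contMDiff_id.prodMk ha)

/-- The shift by `a` is infinitesimally invertible where `1 + da(F) ≠ 0`. -/
theorem IsSmoothFlow.bijective_tmap_shift (hΦ : IsSmoothFlow n Φ) {a : M → ℝ} {x : M}
    (ha : MDifferentiableAt (𝓡 n) 𝓘(ℝ, ℝ) a x) (h : tmap (Eu n) ℝ a x (vfield n Φ x) ≠ -1) :
    Function.Bijective (tmap (Eu n) (Eu n) (fun y => Φ (a y) y) x) := by
  have hinj : Function.Injective (tmap (Eu n) (Eu n) (fun y => Φ (a y) y) x) := by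
    refine (injective_iff_map_eq_zero _).2 fun v hv => ?_
    rw [hΦ.tmap_shift ha] at hv
    have h1 := (injective_iff_map_eq_zero _).1 (hΦ.injective_tmap_time x (a x)) _ hv
    -- Applying `da` to `v + da(v)F = 0` gives `da(v)(1 + da(F)) = 0`.
    have h2 := congrArg (tmap (Eu n) ℝ a x) h1
    rw [map_add, map_smul, map_zero, smul_eq_mul] at h2
    have h3 : tmap (Eu n) ℝ a x v * (1 + tmap (Eu n) ℝ a x (vfield n Φ x)) = 0 := by linarith
    have h4 : tmap (Eu n) ℝ a x v = 0 :=
      (mul_eq_zero.1 h3).resolve_right fun h' => h (by linarith)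
    simpa [h4] using h1
  exact ⟨hinj, (LinearMap.injective_iff_surjective
    (f := (tmap (Eu n) (Eu n) (fun y => Φ (a y) y) x).toLinearMap)).1 hinj⟩

/-- `da(F) ≠ -1` if the derivative of the shift by `a` is injective. -/
theorem IsSmoothFlow.tmap_vfield_ne (hΦ : IsSmoothFlow n Φ) {a : M → ℝ} {x : M}
    (ha : MDifferentiableAt (𝓡 n) 𝓘(ℝ, ℝ) a x)
    (h : Function.Injective (tmap (Eu n) (Eu n) (fun y => Φ (a y) y) x)) :
    tmap (Eu n) ℝ a x (vfield n Φ x) ≠ -1 := by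
  intro h1
  have h2 := hΦ.tmap_shift ha (vfield n Φ x)
  rw [h1, neg_smul, one_smul, add_neg_cancel, map_zero] at h2
  have h3 := (injective_iff_map_eq_zero _).1 h _ h2
  rw [h3, map_zero] at h1
  norm_num at h1

/-- On a trajectory the shift acts on times by `t ↦ t + a (Φ t x)`, which reduces injectivity and
surjectivity to this real function. -/
theorem flow_shift_flow (a : M → ℝ) (x : M) (t : ℝ) :
    Φ (a (Φ t x)) (Φ t x) = Φ (t + a (Φ t x)) x := by
  rw [add_comm, Φ.map_add]

theorem image_shift_orbit_subset (a : M → ℝ) (x : M) :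
    (fun y => Φ (a y) y) '' Φ.orbit x ⊆ Φ.orbit x := by
  rintro _ ⟨_, ⟨t, rfl⟩, rfl⟩
  exact ⟨_, (flow_shift_flow a x t).symm⟩

theorem IsSmoothFlow.shift_mem_E (hΦ : IsSmoothFlow n Φ) (α : C^∞⟮𝓡 n, M; 𝓘(ℝ, ℝ), ℝ⟯) :
    shift Φ α ∈ E n Φ := by
  refine ⟨hΦ.contMDiff_shift α.contMDiff, image_shift_orbit_subset α, fun z hz => ?_⟩
  refine hΦ.bijective_tmap_shift ((α.contMDiff z).mdifferentiableAt (by simp)) ?_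
  rw [vfield_eq_zero_of_mem_Fix hz, map_zero]
  norm_num

/-- A shift is joined to the identity inside every set that contains its scalings. -/
theorem joinedIn_shift {S : Set C(M, M)} {α : C^∞⟮𝓡 n, M; 𝓘(ℝ, ℝ), ℝ⟯}
    (h : ∀ s : I, shift Φ ((s : ℝ) • α) ∈ S) : JoinedIn S (ContinuousMap.id M) (shift Φ α) := by
  refine ⟨⟨⟨fun s => shift Φ ((s : ℝ) • α), ?_⟩, ?_, ?_⟩, h⟩
  · refine ContinuousMap.continuous_of_continuous_uncurry _ ?_
    have hα : Continuous α := α.contMDiff.continuous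
    exact Φ.continuous (t := fun p : I × M => (p.1 : ℝ) * α p.2) (by fun_prop) continuous_snd
  · ext x
    simp [shift]
  · ext x
    simp [shift]

theorem IsSmoothFlow.hasDerivAt_time_shift (hΦ : IsSmoothFlow n Φ) {a : M → ℝ}
    (ha : ContMDiff (𝓡 n) 𝓘(ℝ, ℝ) ∞ a) (x : M) (t : ℝ) :
    HasDerivAt (fun t => t + a (Φ t x)) (1 + tmap (Eu n) ℝ a (Φ t x) (vfield n Φ (Φ t x))) t :=
  (hasDerivAt_id t).add (hΦ.hasDerivAt_comp_curve ((ha _).mdifferentiableAt (by simp)))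

theorem IsSmoothFlow.strictMono_time_shift (hΦ : IsSmoothFlow n Φ) {a : M → ℝ}
    (ha : ContMDiff (𝓡 n) 𝓘(ℝ, ℝ) ∞ a) (hpos : ∀ x, -1 < tmap (Eu n) ℝ a x (vfield n Φ x))
    (x : M) :
    StrictMono fun t => t + a (Φ t x) :=
  strictMono_of_hasDerivAt_pos (hΦ.hasDerivAt_time_shift ha x) fun t => by
    linarith [hpos (Φ t x)]

theorem IsSmoothFlow.injective_shift (hΦ : IsSmoothFlow n Φ) {a : M → ℝ}
    (ha : ContMDiff (𝓡 n) 𝓘(ℝ, ℝ) ∞ a) (hpos : ∀ x, -1 < tmap (Eu n) ℝ a x (vfield n Φ x)) :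
    Function.Injective fun x => Φ (a x) x := by
  intro x y hxy
  have hxy' : Φ (a x) x = Φ (a y) y := hxy
  obtain ⟨t, rfl⟩ : ∃ t, Φ t x = y := by
    refine ⟨-a y + a x, ?_⟩
    rw [Φ.map_add, hxy', ← Φ.map_add, neg_add_cancel, Φ.map_zero_apply]
  rw [flow_shift_flow] at hxy'
  have hT : Φ (t + a (Φ t x) - a x) x = x := flow_sub_eq_of_eq hxy'.symm
  -- `T = t + a (Φ t x) - a x` is a period of `x`, so the time function has the same value at `T`
  -- and at `t`. Monotonicity forces `T = t`, hence `t` itself is a period.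
  have h1 : (fun t => t + a (Φ t x)) (t + a (Φ t x) - a x) = (fun t => t + a (Φ t x)) t := by
    simp only [hT]
    ring
  have h2 := (hΦ.strictMono_time_shift ha hpos x).injective h1
  rw [h2] at hT
  exact hT.symm

/-- If the shift by `a` is onto, then so is the shift by `s * a` for `s ∈ [0, 1]`. -/
theorem IsSmoothFlow.surjective_shift_smul (hΦ : IsSmoothFlow n Φ) {a : M → ℝ}
    (ha : ContMDiff (𝓡 n) 𝓘(ℝ, ℝ) ∞ a) (hpos : ∀ x, -1 < tmap (Eu n) ℝ a x (vfield n Φ x))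
    (hsurj : Function.Surjective fun x => Φ (a x) x) {s : ℝ} (hs : s ∈ Icc (0 : ℝ) 1) :
    Function.Surjective fun x => Φ (s * a x) x := by
  intro y
  have hmono := (hΦ.strictMono_time_shift ha hpos y).monotone
  obtain ⟨t₀, ht₀⟩ : ∃ t, t + a (Φ t y) = 0 := by
    obtain ⟨x, hx⟩ := hsurj y
    have hx' : Φ (a x) x = y := hx
    obtain ⟨t, rfl⟩ : ∃ t, Φ t y = x := by
      refine ⟨-a x, ?_⟩
      rw [← hx', ← Φ.map_add, neg_add_cancel, Φ.map_zero_apply]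
    rw [flow_shift_flow] at hx'
    have h1 : Φ (-a (Φ t y)) y = Φ t y := by
      have h2 := congrArg (Φ (-a (Φ t y))) hx'
      rwa [← Φ.map_add, add_comm t, neg_add_cancel_left, eq_comm] at h2
    exact ⟨-a (Φ t y), by rw [h1]; ring⟩
  have hcont : Continuous fun t => t + s * a (Φ t y) := by
    have h1 : Continuous fun t => Φ t y := Φ.continuous continuous_id continuous_const
    exact continuous_id.add (continuous_const.mul (ha.continuous.comp h1))
  -- The values at `0` and `t₀` are `s * a y` and `(1 - s) * t₀`; monotonicity for `s = 1` gives `a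
  -- y` the sign opposite to `t₀`.
  obtain ⟨t, ht⟩ : ∃ t, t + s * a (Φ t y) = 0 := by
    have ha₀ : a (Φ t₀ y) = -t₀ := by linarith
    have h0 : a (Φ 0 y) = a y := by rw [Φ.map_zero_apply]
    rcases le_total 0 t₀ with h | h
    · have h1 : a y ≤ 0 := by simpa [h0, ht₀] using hmono h
      have h2 : (0 : ℝ) ∈ Icc (0 + s * a (Φ 0 y)) (t₀ + s * a (Φ t₀ y)) := by
        rw [h0, ha₀]
        constructor <;> nlinarith [hs.1, hs.2]
      obtain ⟨t, -, ht⟩ := intermediate_value_Icc h hcont.continuousOn h2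
      exact ⟨t, ht⟩
    · have h1 : 0 ≤ a y := by simpa [h0, ht₀] using hmono h
      have h2 : (0 : ℝ) ∈ Icc (t₀ + s * a (Φ t₀ y)) (0 + s * a (Φ 0 y)) := by
        rw [h0, ha₀]
        constructor <;> nlinarith [hs.1, hs.2]
      obtain ⟨t, -, ht⟩ := intermediate_value_Icc h hcont.continuousOn h2
      exact ⟨t, ht⟩
  refine ⟨Φ t y, ?_⟩
  have h := flow_shift_flow (Φ := Φ) (fun x => s * a x) y t
  simpa only [ht, Φ.map_zero_apply] using h

/-- A bijective smooth map with invertible derivatives is a diffeomorphism. -/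
theorem mem_Diff_of_bijective [IsManifold (𝓡 n) ∞ M] {f : C(M, M)}
    (hf : ContMDiff (𝓡 n) (𝓡 n) ∞ f) (hb : Function.Bijective f)
    (hd : ∀ x, Function.Bijective (tmap (Eu n) (Eu n) f x)) : f ∈ Diff n M := by
  let e := Equiv.ofBijective f hb
  refine ⟨⟨e, hf, fun y => ?_⟩, rfl⟩
  obtain ⟨x, rfl⟩ := hb.2 y
  obtain ⟨P, hx, hP⟩ := isLocalDiffeomorphAt_of_bijective_mfderiv isOpen_univ hf.contMDiffOn
    (mem_univ x) (hd x)
  have hfx : f x ∈ P.target := by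
    rw [hP hx]
    exact P.map_source hx
  refine (P.symm.contMDiffOn.contMDiffAt (P.open_target.mem_nhds hfx)).congr_of_eventuallyEq ?_
  filter_upwards [P.open_target.mem_nhds hfx] with q hq
  refine e.symm_apply_eq.2 ?_
  exact ((hP (P.map_target hq)).trans (P.right_inv hq)).symm

theorem IsSmoothFlow.shift_image_subset_Did [IsManifold (𝓡 n) ∞ M] (hΦ : IsSmoothFlow n Φ) :
    shift Φ '' GamPlus n Φ ⊆ Did n Φ := by
  rintro _ ⟨α, ⟨⟨g, hg⟩, hpos⟩, rfl⟩
  refine joinedIn_shift fun s => ⟨hΦ.shift_mem_E _, ?_⟩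
  have hs := s.2
  have hpos' : ∀ x, -1 < tmap (Eu n) ℝ α x (vfield n Φ x) := hpos
  have hsurj : Function.Surjective fun x => Φ (α x) x := by
    change Function.Surjective (shift Φ α)
    rw [← hg]
    exact g.surjective
  have hmd : ∀ x, MDifferentiableAt (𝓡 n) 𝓘(ℝ, ℝ) α x :=
    fun x => (α.contMDiff x).mdifferentiableAt (by simp)
  have hder : ∀ x v, tmap (Eu n) ℝ ((s : ℝ) • α : C^∞⟮𝓡 n, M; 𝓘(ℝ, ℝ), ℝ⟯) x v =
      s * tmap (Eu n) ℝ α x v := fun x v =>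
    congrArg (fun A : Eu n →L[ℝ] ℝ => A v) (const_smul_mfderiv (hmd x) (s : ℝ))
  have hspos : ∀ x, -1 < tmap (Eu n) ℝ ((s : ℝ) • α : C^∞⟮𝓡 n, M; 𝓘(ℝ, ℝ), ℝ⟯) x
      (vfield n Φ x) := fun x => by
    rw [hder]
    rcases hs.2.eq_or_lt with h | h
    · rw [h, one_mul]
      exact hpos' x
    · nlinarith [hpos' x, mul_nonneg hs.1 (by linarith [hpos' x] :
        (0 : ℝ) ≤ 1 + tmap (Eu n) ℝ α x (vfield n Φ x))]
  have hsmooth := ((s : ℝ) • α).contMDiff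
  refine mem_Diff_of_bijective (hΦ.contMDiff_shift hsmooth) ⟨hΦ.injective_shift hsmooth hspos,
    hΦ.surjective_shift_smul α.contMDiff hpos' hsurj hs⟩ fun x => ?_
  exact hΦ.bijective_tmap_shift ((hsmooth x).mdifferentiableAt (by simp)) (hspos x).ne'

/-! ### Extension over the fixed-point set and the converse inclusions. -/

/-- Smooth time functions extend over the fixed-point set. -/
theorem exists_extension [T2Space M] (hInt : interior (Fix Φ) = ∅)
    (hExt : ∀ z ∈ Fix Φ, IsExtPoint n 0 Φ z) {f : C(M, M)} (hf : ContMDiff (𝓡 n) (𝓡 n) ∞ f)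
    {a : M → ℝ} (ha : ∀ x ∉ Fix Φ, ContMDiffAt (𝓡 n) 𝓘(ℝ, ℝ) ∞ a x)
    (haf : ∀ x ∉ Fix Φ, Φ (a x) x = f x) :
    ∃ α : C^∞⟮𝓡 n, M; 𝓘(ℝ, ℝ), ℝ⟯, (∀ x ∉ Fix Φ, α x = a x) ∧ shift Φ α = f := by
  have hdense : Dense (Fix Φ)ᶜ := interior_eq_empty_iff_dense_compl.1 hInt
  have hopen : IsOpen (Fix Φ)ᶜ := isClosed_Fix.isOpen_compl
  have hoff : ∀ x ∉ Fix Φ, extendFrom (Fix Φ)ᶜ a x = a x := fun x hx =>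
    extendFrom_eq (hdense x) (ha x hx).continuousAt.continuousWithinAt
  have hsmooth : ContMDiff (𝓡 n) 𝓘(ℝ, ℝ) ∞ (extendFrom (Fix Φ)ᶜ a) := by
    intro z
    by_cases hz : z ∈ Fix Φ
    · obtain ⟨-, V, hV, hzV, hext⟩ := hExt z hz
      obtain ⟨β, hβ, hβα⟩ := hext (fun p => a p.1)
        (fun p hp => ((ha p.1 hp.1.2).comp p contMDiffAt_fst).contMDiffWithinAt)
        ⟨fun p => f p.1, (hf.comp contMDiff_fst).contMDiffOn, fun p hp => (haf p.1 hp.1.2).symm⟩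
      have h0 : (0 : Eu 0) ∈ disk 0 := Metric.mem_ball_self one_pos
      have hb : ContMDiffOn (𝓡 n) 𝓘(ℝ, ℝ) ∞ (fun x => β (x, 0)) V :=
        hβ.comp (contMDiff_id.prodMk contMDiff_const).contMDiffOn fun x hx => ⟨hx, h0⟩
      refine (hb.contMDiffAt (hV.mem_nhds hzV)).congr_of_eventuallyEq ?_
      filter_upwards [hV.mem_nhds hzV] with y hy
      -- At every `y ∈ V`, fixed or not, `β` is the limit of `a` along the dense complement of `Fix
      -- Φ`, so the local extensions agree with one global function.
      refine extendFrom_eq (hdense y) ?_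
      refine ((hb.continuousOn.continuousAt (hV.mem_nhds hy)).tendsto.mono_left
        nhdsWithin_le_nhds).congr' ?_
      filter_upwards [self_mem_nhdsWithin, nhdsWithin_le_nhds (hV.mem_nhds hy)] with w hw hwV
      exact hβα ⟨⟨hwV, hw⟩, h0⟩
    · refine (ha z hz).congr_of_eventuallyEq ?_
      filter_upwards [hopen.mem_nhds hz] with y hy
      exact hoff y hy
  refine ⟨⟨extendFrom (Fix Φ)ᶜ a, hsmooth⟩, hoff, ?_⟩
  refine DFunLike.coe_injective (Continuous.ext_on hdense (ContinuousMap.continuous _)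
    f.continuous fun x hx => ?_)
  change Φ (extendFrom (Fix Φ)ᶜ a x) x = f x
  rw [hoff x hx, haf x hx]

variable [T2Space M] [IsManifold (𝓡 n) ∞ M] [SecondCountableTopology M]

/-- The end of a path in `E(Φ)` from the identity is a shift, by the end value of a continuous lift
of the path to times. -/
theorem IsSmoothFlow.exists_shift_eq_of_path (hΦ : IsSmoothFlow n Φ)
    (hInt : interior (Fix Φ) = ∅) (hExt : ∀ z ∈ Fix Φ, IsExtPoint n 0 Φ z) {f : C(M, M)}
    (γ : Path (ContinuousMap.id M) f) (hγ : ∀ s, γ s ∈ E n Φ) :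
    ∃ (α : C^∞⟮𝓡 n, M; 𝓘(ℝ, ℝ), ℝ⟯) (a : M → I → ℝ), shift Φ α = f ∧
      ∀ x ∉ Fix Φ, Continuous (a x) ∧ a x 0 = 0 ∧ a x 1 = α x ∧ ∀ s, Φ (a x s) x = γ s x := by
  have : LocallyCompactSpace M := Manifold.locallyCompact_of_finiteDimensional (𝓡 n)
  have : TopologicalSpace.MetrizableSpace M := Manifold.metrizableSpace (𝓡 n) M
  have hH : Continuous fun p : M × I => γ p.2 p.1 := by fun_prop
  obtain ⟨a, ha⟩ := hΦ.exists_lift hH (by simp)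
    fun x s => (hγ s).2.1 x (mem_image_of_mem _ (Φ.mem_orbit_self x))
  have hf : f ∈ E n Φ := by simpa using hγ 1
  have haf : ∀ x ∉ Fix Φ, Φ (a x 1) x = f x := fun x hx => by simpa using (ha x hx).2.2.1 1
  obtain ⟨α, hα, hαf⟩ := exists_extension hInt hExt hf.1 (a := fun x => a x 1) (fun x hx => by
    refine hΦ.contMDiffAt_of_continuousAt hx (hf.1 x) ((ha x hx).2.2.2 1) ?_
    filter_upwards [isClosed_Fix.isOpen_compl.mem_nhds hx] with y hy
    exact haf y hy) haf
  exact ⟨α, a, hαf, fun x hx => ⟨(ha x hx).1, (ha x hx).2.1, (hα x hx).symm, (ha x hx).2.2.1⟩⟩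

theorem IsSmoothFlow.Did_subset_shift_image (hΦ : IsSmoothFlow n Φ)
    (hInt : interior (Fix Φ) = ∅) (hExt : ∀ z ∈ Fix Φ, IsExtPoint n 0 Φ z) :
    Did n Φ ⊆ shift Φ '' GamPlus n Φ := by
  rintro f ⟨γ, hγ⟩
  obtain ⟨α, a, rfl, ha⟩ := hΦ.exists_shift_eq_of_path hInt hExt γ fun s => (hγ s).1
  have hdiff : shift Φ α ∈ Diff n M := by simpa using (hγ 1).2
  refine ⟨α, ⟨hdiff, fun x => ?_⟩, rfl⟩
  change -1 < tmap (Eu n) ℝ α x (vfield n Φ x)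
  by_cases hx : x ∈ Fix Φ
  · rw [vfield_eq_zero_of_mem_Fix hx, map_zero]
    norm_num
  have hmd : MDifferentiableAt (𝓡 n) 𝓘(ℝ, ℝ) α x := (α.contMDiff x).mdifferentiableAt (by simp)
  have hne : tmap (Eu n) ℝ α x (vfield n Φ x) ≠ -1 := by
    refine hΦ.tmap_vfield_ne hmd ?_
    obtain ⟨g, hg⟩ := hdiff
    change Function.Injective (tmap (Eu n) (Eu n) (shift Φ α) x)
    rw [← hg]
    have h1 : (fun y => g.symm (g y)) = fun y => y := funext g.symm_apply_apply
    have h2 := tmap_comp (g.symm.contMDiff.contMDiffAt.mdifferentiableAt (by simp))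
      (g.contMDiff.contMDiffAt.mdifferentiableAt (by simp)) (rfl : g x = g x)
    simp only [h1, tmap_id] at h2
    intro v w hvw
    rw [h2 v, h2 w, hvw]
  obtain ⟨δ, hδ, hper⟩ := hΦ.exists_period_bound hx
  -- Otherwise `t + a (Φ t x) s - a x s` goes from `t > 0` at `s = 0` to a value `≤ 0` at `s = 1`.
  -- At a zero, `γ s` identifies `x` with `Φ t x`, which are distinct as `t` is below the period
  -- bound.
  have hincr : ∀ t ∈ Ioo 0 δ, α x < t + α (Φ t x) := by
    rintro t ⟨ht, htδ⟩
    have hxt := flow_notMem_Fix hx t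
    obtain ⟨hc, h0, h1, hl⟩ := ha x hx
    obtain ⟨hc', h0', h1', hl'⟩ := ha _ hxt
    by_contra! hle
    obtain ⟨s, hs⟩ : ∃ s, t + a (Φ t x) s - a x s = 0 :=
      mem_range_of_exists_le_of_exists_ge (f := fun s => t + a (Φ t x) s - a x s) (by fun_prop)
        ⟨1, by simp only [h1, h1']; linarith⟩ ⟨0, by simp only [h0, h0']; linarith⟩
    have h2 : γ s (Φ t x) = γ s x := by
      rw [← hl, ← hl', ← Φ.map_add, add_comm, sub_eq_zero.1 hs]
    obtain ⟨g, hg⟩ := (hγ s).2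
    rw [← hg] at h2
    exact ht.ne' (hper t (by rwa [abs_of_pos ht]) (g.injective h2))
  have hder := hΦ.hasDerivAt_time_shift α.contMDiff x 0
  rw [Φ.map_zero_apply] at hder
  have hnonneg : 0 ≤ 1 + tmap (Eu n) ℝ α x (vfield n Φ x) := by
    refine ge_of_tendsto hder.tendsto_slope_zero_right ?_
    filter_upwards [Ioo_mem_nhdsGT hδ] with t ht
    have h1 := hincr t ht
    simp only [zero_add, Φ.map_zero_apply, smul_eq_mul]
    exact mul_nonneg (inv_nonneg.2 ht.1.le) (by linarith)
  exact lt_of_le_of_ne (by linarith) hne.symm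

end Shift

end ShiftMap

theorem mainTheorem4 {n : ℕ} {M : Type*} [TopologicalSpace M] [T2Space M]
    [SecondCountableTopology M] [ConnectedSpace M]
    [ChartedSpace (EuclideanSpace ℝ (Fin n)) M] [IsManifold (𝓡 n) ∞ M]
    (Φ : Flow ℝ M) (hΦ : ShiftMap.IsSmoothFlow n Φ)
    (hInt : interior (ShiftMap.Fix Φ) = ∅)
    (hExt : ∀ z ∈ ShiftMap.Fix Φ, ShiftMap.IsExtPoint n 0 Φ z) :
    Set.range (ShiftMap.shift (n := n) Φ) = ShiftMap.Eid n Φ ∧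
      ShiftMap.shift Φ '' ShiftMap.GamPlus n Φ = ShiftMap.Did n Φ := by
  refine ⟨Set.Subset.antisymm ?_ ?_, Set.Subset.antisymm hΦ.shift_image_subset_Did
    (hΦ.Did_subset_shift_image hInt hExt)⟩
  · rintro _ ⟨α, rfl⟩
    exact ShiftMap.joinedIn_shift fun s => hΦ.shift_mem_E _
  · rintro f ⟨γ, hγ⟩
    obtain ⟨α, -, hα, -⟩ := hΦ.exists_shift_eq_of_path hInt hExt γ hγ
    exact ⟨α, hα⟩
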